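/- Let $K$ be a commutative ring with $1 \neq 0$ and let $G$ be a finitely generated group of type $FP_2$ over $K$; that is, the trivial $KG$-module $K$ has a resolution $\cdots \to P_2 \to P_1 \to P_0 \to K \to 0$ by projective $KG$-modules in which $P_0, P_1, P_2$ are finitely generated. Let $\chi\colon G \to \mathbb{Z}$ be a rank 1 character (a non-zero homomorphism) and let $t \in G$ be an element with $\chi(t) = 1$. Then there exist finitely generated subgroups $S$, $T$, $B$ of $\ker \chi$ with $S \subseteq B$ and $T \subseteq B$, such that conjugation by $t$ induces an isomorphism $\mu\colon S \to T$, $\mu(s) = t s t^{-1}$ (so $T = tSt^{-1}$), and such that the inclusion $B \hookrightarrow G$ and the assignment $y \mapsto t$ induce an isomorphism $$\tau\colon \langle B, y \mid y s y^{-1} = \mu(s) \text{ for all } s \in S\rangle \longrightarrow G .$$ That is, $G$ is an HNN-extension with stable letter $t$, finitely generated base group $B \subseteq \ker\chi$ and finitely generated associated subgroups $S$ and $T$. -/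

import Mathlib

universe u v

/-- A (left) module `A` over a ring `R` is of type `FP_n` if it has a projective resolution
`⋯ → P₂ → P₁ → P₀ → A → 0` in which `P₀, …, Pₙ` are finitely generated.
(Taking the `P i` in the universe of `R` is no restriction: finitely generated modules and the
kernels of maps between them have copies there.) -/
def Module.IsTypeFP (R : Type u) [Ring R] (A : Type v) [AddCommGroup A] [Module R A] (n : ℕ) :
    Prop :=
  ∃ (P : ℕ → ModuleCat.{u} R) (d : ∀ i, P (i + 1) →ₗ[R] P i) (ε : P 0 →ₗ[R] A),
    Function.Surjective ε ∧ Function.Exact (d 0) ε ∧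
    (∀ i, Function.Exact (d (i + 1)) (d i)) ∧
    (∀ i, Module.Projective R (P i)) ∧
    (∀ i, i ≤ n → Module.Finite R (P i))

/-- The module `K` over the group ring of `G` on which every element of `G` acts as the
identity. -/
abbrev TrivialGroupModule (K : Type u) [CommRing K] (G : Type v) [Group G] : Type u :=
  (Representation.trivial K G K).asModule

/-- A group `G` is of type `FP_n` over a commutative ring `K` if the trivial module `K` over the
group ring `K[G]` is of type `FP_n`. -/
def Group.IsTypeFP (K : Type u) [CommRing K] (G : Type v) [Group G] (n : ℕ) : Prop :=
  Module.IsTypeFP (MonoidAlgebra K G) (TrivialGroupModule K G) n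

/-! Choose generators `t`, `x i` of `G` with every `x i` in `ker χ`. Let `B_n` be generated by the
conjugates `t ^ k * x i * (t ^ k)⁻¹` with `0 ≤ k ≤ n`, and let `H_n` be the HNN extension of `B_n`
along conjugation by `t` from levels `0, …, n - 1` to levels `1, …, n`. The map `H_n → G` is onto
and injective on `B_n`, and each relator of `G` already holds in `H_n` for large `n`. Finite
presentability would finish the proof here.

Type `FP₂` gives less: the relation module over `K[G]` is finitely generated
(`Group.IsTypeFP.exists_finite_relators`). So for large `n` every derivation from `H_n` to a
`K[G]`-module vanishes on the kernel `N` of `H_n → G`. As `N` meets no conjugate of the base, it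
acts freely on the Bass-Serre tree, hence is free, and a free group without non-zero homology over
`K` is trivial. `HNNExtension.injective_of_edgeDerivation_eq_zero` makes this combinatorial, using
the derivation that sends an element to the chain of edges crossed by its path in the quotient
graph. -/

/-! ### Finiteness of kernels: a Schanuel argument -/

section
open Module

/-- Schanuel's comparison carries the finite presentation of `ker ε` over to `ker η`; any surjection
from a finitely generated module onto `ker η` then has finitely generated kernel. -/
theorem LinearMap.fg_ker_of_exact_of_projective {R : Type*} [Ring R] {A P₀ P₁ P₂ F₀ F₁ : Type*}
    [AddCommGroup A] [Module R A] [AddCommGroup P₀] [Module R P₀] [AddCommGroup P₁] [Module R P₁]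
    [AddCommGroup P₂] [Module R P₂] [AddCommGroup F₀] [Module R F₀] [AddCommGroup F₁] [Module R F₁]
    [Projective R P₀] [Projective R P₁] [Projective R F₀]
    [Module.Finite R P₀] [Module.Finite R P₁] [Module.Finite R P₂] [Module.Finite R F₀]
    [Module.Finite R F₁]
    {d₁ : P₂ →ₗ[R] P₁} {d₀ : P₁ →ₗ[R] P₀} {ε : P₀ →ₗ[R] A} (hε : Function.Surjective ε)
    (h₀ : Function.Exact d₀ ε) (h₁ : Function.Exact d₁ d₀)
    {δ : F₁ →ₗ[R] F₀} {η : F₀ →ₗ[R] A} (hη : Function.Surjective η) (hδ : Function.Exact δ η) :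
    (LinearMap.ker δ).FG := by
  have hP₁ := finitePresentation_of_projective R P₁
  have hF₀ := finitePresentation_of_projective R F₀
  have hZ : FinitePresentation R (ker ε) := by
    refine finitePresentation_of_surjective
      (d₀.codRestrict (ker ε) fun x => LinearMap.mem_ker.2 (h₀.apply_apply_eq_zero x)) ?_ ?_
    · rintro ⟨z, hz⟩
      obtain ⟨x, rfl⟩ := (h₀ z).1 hz
      exact ⟨x, rfl⟩
    · rw [LinearMap.ker_codRestrict, LinearMap.exact_iff.1 h₁, LinearMap.range_eq_map]
      exact Module.Finite.fg_top.map _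
  obtain ⟨a, ha⟩ := projective_lifting_property ε η hε
  obtain ⟨b, hb⟩ := projective_lifting_property η ε hη
  replace ha : ∀ x, ε (a x) = η x := fun x => LinearMap.congr_fun ha x
  replace hb : ∀ x, η (b x) = ε x := fun x => LinearMap.congr_fun hb x
  have hI : FinitePresentation R (ker η) := by
    -- This map sends its source onto `ker η`, and its kernel is a copy of `P₀` modulo a submodule,
    -- parametrized by `p = z + a f`.
    let ψ : (ker ε × F₀) →ₗ[R] F₀ :=
      LinearMap.snd R _ _ - b ∘ₗ ((ker ε).subtype.coprod a)
    have hψ : ∀ x, ψ x = x.2 - b (x.1 + a x.2) := fun x => rfl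
    have hψ' : ∀ x, ψ x ∈ ker η := fun x => by
      have := x.1.2
      rw [LinearMap.mem_ker] at this ⊢
      simp [hψ, hb, ha, this]
    refine finitePresentation_of_surjective (ψ.codRestrict (ker η) hψ') ?_ ?_
    · rintro ⟨i, hi⟩
      refine ⟨⟨⟨-a i, ?_⟩, i⟩, ?_⟩
      · rw [LinearMap.mem_ker] at hi ⊢
        simp [ha, hi]
      · ext
        simp [hψ]
    · rw [LinearMap.ker_codRestrict]
      let κ : P₀ →ₗ[R] (ker ε × F₀) :=
        LinearMap.prod (LinearMap.codRestrict (ker ε) (LinearMap.id - a ∘ₗ b)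
          fun x => by simp [ha, hb]) b
      have : ker ψ = range κ := by
        ext ⟨z, f⟩
        rw [LinearMap.mem_ker, LinearMap.mem_range, hψ]
        constructor
        · intro h
          rw [sub_eq_zero] at h
          simp only at h
          refine ⟨z + a f, Prod.ext (Subtype.ext ?_) h.symm⟩
          change (z : P₀) + a f - a (b (z + a f)) = z
          rw [← h, add_sub_cancel_right]
        · rintro ⟨p, hp⟩
          obtain ⟨h1, h2⟩ := Prod.ext_iff.1 hp
          replace h1 := congrArg Subtype.val h1
          change p - a (b p) = z at h1
          change b p = f at h2
          simp [← h1, ← h2]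
      rw [this, LinearMap.range_eq_map]
      exact Module.Finite.fg_top.map _
  let δ' : F₁ →ₗ[R] ker η :=
    δ.codRestrict (ker η) fun x => LinearMap.mem_ker.2 (hδ.apply_apply_eq_zero x)
  have hδ' : Function.Surjective δ' := by
    rintro ⟨z, hz⟩
    obtain ⟨x, rfl⟩ := (hδ z).1 hz
    exact ⟨x, rfl⟩
  have := FinitePresentation.fg_ker δ' hδ'
  rwa [show ker δ' = ker δ from LinearMap.ker_codRestrict _ _ _] at this
end

/-! ### Crossed homomorphisms -/

/-- `d` is a crossed homomorphism (derivation, 1-cocycle) for the action `ρ`. -/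
def IsCrossedHom {H A : Type*} [Group H] [AddCommGroup A] (ρ : H →* AddMonoid.End A)
    (d : H → A) : Prop :=
  ∀ x y, d (x * y) = d x + ρ x (d y)

namespace IsCrossedHom

variable {H A : Type*} [Group H] [AddCommGroup A] {ρ : H →* AddMonoid.End A} {d : H → A}

theorem map_one (hd : IsCrossedHom ρ d) : d 1 = 0 := by
  have := hd 1 1
  simpa using this

theorem map_inv (hd : IsCrossedHom ρ d) (x : H) : d x⁻¹ = -ρ x⁻¹ (d x) := by
  have := hd x⁻¹ x
  rw [inv_mul_cancel, hd.map_one] at this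
  exact eq_neg_of_add_eq_zero_left this.symm

theorem comp {H' : Type*} [Group H'] (hd : IsCrossedHom ρ d) (f : H' →* H) :
    IsCrossedHom (ρ.comp f) (d ∘ f) := fun x y => by
  simp [hd (f x) (f y)]

theorem map {A' : Type*} [AddCommGroup A'] {ρ' : H →* AddMonoid.End A'} (hd : IsCrossedHom ρ d)
    (f : A →+ A') (hf : ∀ x a, f (ρ x a) = ρ' x (f a)) : IsCrossedHom ρ' (f ∘ d) := fun x y => by
  simp [hd x y, hf]

theorem eq_of_freeGroup {X : Type*} {ρ : FreeGroup X →* AddMonoid.End A}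
    {d d' : FreeGroup X → A} (hd : IsCrossedHom ρ d) (hd' : IsCrossedHom ρ d')
    (h : ∀ x, d (FreeGroup.of x) = d' (FreeGroup.of x)) (r : FreeGroup X) : d r = d' r := by
  induction r using FreeGroup.induction_on with
  | C1 => rw [hd.map_one, hd'.map_one]
  | of x => exact h x
  | inv_of x hx => rw [hd.map_inv, hd'.map_inv, hx]
  | mul x y hx hy => rw [hd, hd', hx, hy]

theorem action_mul (ρ : H →* AddMonoid.End A) (x y : H) (a : A) :
    ρ (x * y) a = ρ x (ρ y a) := by
  rw [map_mul]
  rfl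

/-- The affine permutation `a ↦ ρ x a + c`. -/
def affinePerm (ρ : H →* AddMonoid.End A) (x : H) (c : A) : Equiv.Perm A where
  toFun a := ρ x a + c
  invFun a := ρ x⁻¹ (a - c)
  left_inv a := by
    simp [← action_mul]
  right_inv a := by
    simp [← action_mul]

theorem affinePerm_apply (x : H) (c a : A) : affinePerm ρ x c a = ρ x a + c := rfl

/-- A crossed homomorphism is the translation part of an action by affine maps, so universal
properties for homomorphisms also construct derivations. -/
theorem of_affine (Φ : H →* Equiv.Perm A) (h : ∀ x, ∃ c, Φ x = affinePerm ρ x c) :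
    IsCrossedHom ρ fun x => Φ x 0 := fun x y => by
  obtain ⟨c, hc⟩ := h x
  simp [hc, affinePerm_apply, add_comm]

theorem affine_one : ∃ c, (1 : Equiv.Perm A) = affinePerm ρ 1 c :=
  ⟨0, by ext; simp [affinePerm_apply]⟩

theorem affine_mul (Φ : H →* Equiv.Perm A) {x y : H} (hx : ∃ c, Φ x = affinePerm ρ x c)
    (hy : ∃ c, Φ y = affinePerm ρ y c) : ∃ c, Φ (x * y) = affinePerm ρ (x * y) c := by
  obtain ⟨c, hc⟩ := hx
  obtain ⟨e, he⟩ := hy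
  exact ⟨ρ x e + c, by ext; simp [affinePerm_apply, hc, he, add_assoc]⟩

theorem affine_inv (Φ : H →* Equiv.Perm A) {x : H} (hx : ∃ c, Φ x = affinePerm ρ x c) :
    ∃ c, Φ x⁻¹ = affinePerm ρ x⁻¹ c := by
  obtain ⟨c, hc⟩ := hx
  refine ⟨-ρ x⁻¹ c, ?_⟩
  rw [_root_.map_inv, hc]
  ext a
  change ρ x⁻¹ (a - c) = _
  simp [affinePerm_apply, sub_eq_add_neg]

theorem exists_freeGroup {X : Type*} (ρ : FreeGroup X →* AddMonoid.End A) (f : X → A) :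
    ∃ d, IsCrossedHom ρ d ∧ ∀ x, d (FreeGroup.of x) = f x := by
  let Φ : FreeGroup X →* Equiv.Perm A :=
    FreeGroup.lift fun x => affinePerm ρ (FreeGroup.of x) (f x)
  refine ⟨fun x => Φ x 0, of_affine Φ fun r => ?_, fun x => by simp [Φ, affinePerm_apply]⟩
  induction r using FreeGroup.induction_on with
  | C1 => simpa using affine_one
  | of x => exact ⟨f x, by simp [Φ]⟩
  | inv_of x hx => exact affine_inv Φ hx
  | mul x y hx hy => exact affine_mul Φ hx hy

/-- The base acts linearly and `t` acts with translation part `c`; the HNN relations hold because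
`T` fixes `c`. -/
theorem exists_hnnExtension {B : Type*} [Group B] {S T : Subgroup B} {μ : S ≃* T}
    (ρ : HNNExtension B S T μ →* AddMonoid.End A) (c : A)
    (hc : ∀ s : T, ρ (HNNExtension.of (s : B)) c = c) :
    ∃ d, IsCrossedHom ρ d ∧ (∀ b, d (HNNExtension.of b) = 0) ∧ d HNNExtension.t = c := by
  let f : B →* Equiv.Perm A :=
    { toFun b := affinePerm ρ (HNNExtension.of b) 0
      map_one' := by ext; simp [affinePerm_apply]
      map_mul' x y := by ext; simp [affinePerm_apply] }
  have hf : ∀ b, f b = affinePerm ρ (HNNExtension.of b) 0 := fun _ => rfl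
  let Φ : HNNExtension B S T μ →* Equiv.Perm A :=
    HNNExtension.lift f (affinePerm ρ HNNExtension.t c) fun s => by
      ext a
      simp only [hf, Equiv.Perm.mul_apply, affinePerm_apply, add_zero, map_add, hc]
      simp only [← action_mul, HNNExtension.t_mul_of]
  refine ⟨fun x => Φ x 0, of_affine Φ fun r => ?_, fun b => by simp [Φ, hf, affinePerm_apply],
    by simp [Φ, affinePerm_apply]⟩
  induction r using HNNExtension.induction_on with
  | of b => exact ⟨0, by simp [Φ, hf]⟩
  | t => exact ⟨c, by simp [Φ]⟩
  | inv x hx => exact affine_inv Φ hx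
  | mul x y hx hy => exact affine_mul Φ hx hy

end IsCrossedHom

/-! ### Fox calculus and the relation module -/

/-- The action of `G` on a module over its group ring. -/
noncomputable def MonoidAlgebra.moduleAction (K : Type*) [CommRing K] (G : Type*) [Group G]
    (A : Type*) [AddCommGroup A] [Module (MonoidAlgebra K G) A] : G →* AddMonoid.End A :=
  (Module.toAddMonoidEnd (MonoidAlgebra K G) A).toMonoidHom.comp (MonoidAlgebra.of K G)

theorem MonoidAlgebra.moduleAction_apply (K : Type*) [CommRing K] {G : Type*} [Group G]
    {A : Type*} [AddCommGroup A] [Module (MonoidAlgebra K G) A] (g : G) (a : A) :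
    MonoidAlgebra.moduleAction K G A g a = MonoidAlgebra.of K G g • a := rfl

section FoxCalculus

open MonoidAlgebra

variable (K : Type*) [CommRing K] {G : Type*} [Group G] {X : Type*} (φ : FreeGroup X →* G)

/-- The boundary map `e_x ↦ x - 1` from the free module on the generators to the group ring. -/
noncomputable def foxBoundary : (X →₀ MonoidAlgebra K G) →ₗ[MonoidAlgebra K G] MonoidAlgebra K G :=
  Finsupp.linearCombination _ fun x => of K G (φ (FreeGroup.of x)) - 1

theorem foxBoundary_single (x : X) (r : MonoidAlgebra K G) :
    foxBoundary K φ (Finsupp.single x r) = r * (of K G (φ (FreeGroup.of x)) - 1) := by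
  simp [foxBoundary]

theorem isCrossedHom_of_sub_one {A : Type*} [AddCommGroup A] [Module (MonoidAlgebra K G) A]
    (f : MonoidAlgebra K G →ₗ[MonoidAlgebra K G] A) :
    IsCrossedHom ((moduleAction K G A).comp φ) fun r => f (of K G (φ r) - 1) := fun x y => by
  rw [MonoidHom.comp_apply, moduleAction_apply, ← map_smul, ← map_add]
  change f _ = f _
  rw [map_mul, map_mul, smul_eq_mul, mul_sub, mul_one]
  congr 1
  abel

theorem isCrossedHom_zero {A : Type*} [AddCommGroup A] (ρ : G →* AddMonoid.End A) :
    IsCrossedHom ρ fun _ => 0 := fun x y => by simp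

theorem of_sub_one_mem_range_foxBoundary (f : FreeGroup X) :
    of K G (φ f) - 1 ∈ LinearMap.range (foxBoundary K φ) := by
  rw [← Submodule.Quotient.mk_eq_zero]
  refine (isCrossedHom_of_sub_one K φ (Submodule.mkQ _)).eq_of_freeGroup
    (isCrossedHom_zero _) (fun x => ?_) f
  rw [Submodule.mkQ_apply, Submodule.Quotient.mk_eq_zero]
  exact ⟨Finsupp.single x 1, by simp [foxBoundary_single]⟩

variable (G) in
/-- The augmentation map onto the trivial module. -/
noncomputable def trivialAugmentation :
    MonoidAlgebra K G →ₗ[MonoidAlgebra K G] TrivialGroupModule K G :=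
  LinearMap.toSpanSingleton _ _ ((Representation.trivial K G K).asModuleEquiv.symm 1)

theorem trivialAugmentation_of (g : G) :
    trivialAugmentation K G (of K G g) = (Representation.trivial K G K).asModuleEquiv.symm 1 := by
  rw [trivialAugmentation, LinearMap.toSpanSingleton_apply,
    ← Representation.asModuleEquiv_symm_map_rho]
  rfl

theorem trivialAugmentation_algebraMap (k : K) :
    trivialAugmentation K G (algebraMap K _ k) =
      (Representation.trivial K G K).asModuleEquiv.symm k := by
  rw [trivialAugmentation, LinearMap.toSpanSingleton_apply,
    ← Representation.asModuleEquiv_symm_map_smul, smul_eq_mul, mul_one]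

theorem trivialAugmentation_surjective : Function.Surjective (trivialAugmentation K G) :=
  fun y => ⟨algebraMap K _ ((Representation.trivial K G K).asModuleEquiv y), by
    rw [trivialAugmentation_algebraMap, LinearEquiv.symm_apply_apply]⟩

theorem exact_foxBoundary_trivialAugmentation (hφ : Function.Surjective φ) :
    Function.Exact (foxBoundary K φ) (trivialAugmentation K G) := by
  have h1 : trivialAugmentation K G 1 = (Representation.trivial K G K).asModuleEquiv.symm 1 := by
    rw [← trivialAugmentation_of K (1 : G), MonoidHom.map_one]
  have hcomp : ∀ v, trivialAugmentation K G (foxBoundary K φ v) = 0 := by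
    intro v
    rw [← LinearMap.comp_apply]
    suffices trivialAugmentation K G ∘ₗ foxBoundary K φ = 0 by rw [this]; rfl
    refine Finsupp.lhom_ext fun x r => ?_
    rw [LinearMap.comp_apply, foxBoundary_single, ← smul_eq_mul, map_smul, map_sub,
      trivialAugmentation_of, h1, sub_self, smul_zero]
    rfl
  intro r
  constructor
  -- Modulo the boundaries every element is a scalar, and the augmentation detects scalars.
  · have key : ∀ r : MonoidAlgebra K G, ∃ k : K,
        r - algebraMap K _ k ∈ LinearMap.range (foxBoundary K φ) := by
      intro r
      induction r using MonoidAlgebra.induction_on with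
      | of g =>
        obtain ⟨f, rfl⟩ := hφ g
        exact ⟨1, by rw [map_one]; exact of_sub_one_mem_range_foxBoundary K φ f⟩
      | add a b ha hb =>
        obtain ⟨k, hk⟩ := ha
        obtain ⟨l, hl⟩ := hb
        refine ⟨k + l, ?_⟩
        rw [map_add, add_sub_add_comm]
        exact add_mem hk hl
      | smul c a ha =>
        obtain ⟨k, hk⟩ := ha
        refine ⟨c * k, ?_⟩
        rw [map_mul, Algebra.smul_def, ← mul_sub]
        exact Submodule.smul_mem _ _ hk
    obtain ⟨k, v, hv⟩ := key r
    intro hr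
    have h2 := hcomp v
    rw [hv, map_sub, hr, trivialAugmentation_algebraMap, zero_sub, neg_eq_zero,
      LinearEquiv.map_eq_zero_iff] at h2
    rw [h2, map_zero, sub_zero] at hv
    exact ⟨v, hv⟩
  · rintro ⟨v, rfl⟩
    exact hcomp v

variable {K φ} in
/-- The relation module is spanned by the Fox derivatives of the relators. -/
theorem ker_foxBoundary_eq_span (hφ : Function.Surjective φ)
    {D : FreeGroup X → X →₀ MonoidAlgebra K G}
    (hD : IsCrossedHom ((moduleAction K G _).comp φ) D)
    (hD' : ∀ x, D (FreeGroup.of x) = Finsupp.single x 1) :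
    LinearMap.ker (foxBoundary K φ) = Submodule.span (MonoidAlgebra K G) (D '' (φ.ker : Set _)) := by
  have hDact : ∀ x y, D (x * y) = D x + of K G (φ x) • D y := hD
  apply le_antisymm
  · set L := Submodule.span (MonoidAlgebra K G) (D '' (φ.ker : Set _)) with hL
    let σ := Function.surjInv hφ
    have hσ : ∀ g, φ (σ g) = g := Function.surjInv_eq hφ
    -- Modulo `L` the derivation `D` descends to `G`. Its `K`-linear extension `s` satisfies `s (∂
    -- v) = v` modulo `L`, so cycles lie in `L`.
    let E : G → (X →₀ MonoidAlgebra K G) ⧸ L := fun g => L.mkQ (D (σ g))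
    have hE : ∀ f, L.mkQ (D f) = E (φ f) := fun f => by
      have : f = σ (φ f) * ((σ (φ f))⁻¹ * f) := by group
      conv_lhs => rw [this, hDact, map_add, map_smul]
      rw [(L.mkQ_apply (D ((σ (φ f))⁻¹ * f))).trans ((Submodule.Quotient.mk_eq_zero _).2
        (Submodule.subset_span ⟨_, by simp [MonoidHom.mem_ker, hσ], rfl⟩)), smul_zero, add_zero]
    have hE' : ∀ g f, E (g * φ f) = E g + of K G g • L.mkQ (D f) := fun g f => by
      have := hE (σ g * f)
      rw [map_mul, hσ] at this
      rw [← this, hDact, map_add, map_smul, hσ]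
    let s : MonoidAlgebra K G →ₗ[K] (X →₀ MonoidAlgebra K G) ⧸ L :=
      Finsupp.linearCombination K E ∘ₗ (coeffLinearEquiv K).toLinearMap
    have hs : ∀ g, s (of K G g) = E g := fun g => by simp [s]
    have key : ∀ v, s (foxBoundary K φ v) = L.mkQ v := by
      intro v
      induction v using Finsupp.induction_linear with
      | zero => simp
      | add v w hv hw => rw [map_add, map_add, map_add, hv, hw]
      | single x r =>
        rw [foxBoundary_single]
        induction r using MonoidAlgebra.induction_on with
        | of g =>
          rw [mul_sub, mul_one, ← map_mul, map_sub, hs, hs, hE', add_sub_cancel_left, hD',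
            ← map_smul, Finsupp.smul_single, smul_eq_mul, mul_one]
        | add a b ha hb => rw [add_mul, map_add, ha, hb, Finsupp.single_add, map_add]
        | smul c a ha =>
          rw [smul_mul_assoc, map_smul, ha, ← Finsupp.smul_single]
          rfl
    intro v hv
    rw [LinearMap.mem_ker] at hv
    have := key v
    rw [hv, map_zero] at this
    exact (Submodule.Quotient.mk_eq_zero _).1 this.symm
  · rw [Submodule.span_le]
    rintro _ ⟨r, hr, rfl⟩
    -- Fundamental formula of Fox calculus: the boundary of `D r` is `φ r - 1`.
    have h : IsCrossedHom ((moduleAction K G _).comp φ) (foxBoundary K φ ∘ D) :=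
      hD.map (foxBoundary K φ).toAddMonoidHom fun x a => map_smul (foxBoundary K φ) _ _
    have := h.eq_of_freeGroup (isCrossedHom_of_sub_one K φ LinearMap.id)
      (fun x => by simp [hD', foxBoundary_single]) r
    rw [SetLike.mem_coe, LinearMap.mem_ker]
    rw [SetLike.mem_coe, MonoidHom.mem_ker] at hr
    refine this.trans ?_
    rw [hr, map_one, sub_self, map_zero]

/-- For a group of type `FP₂` over `K`, finitely many relators detect whether a derivation vanishes
on all relators. -/
theorem Group.IsTypeFP.exists_finite_relators {K : Type u} [CommRing K] {G : Type v} [Group G]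
    (hG : Group.IsTypeFP K G 2) {X : Type*} [Finite X] {φ : FreeGroup X →* G}
    (hφ : Function.Surjective φ) :
    ∃ R : Set (FreeGroup X), R.Finite ∧ R ⊆ φ.ker ∧
      ∀ {A : Type*} [AddCommGroup A] [Module (MonoidAlgebra K G) A] (d : FreeGroup X → A),
        IsCrossedHom ((moduleAction K G A).comp φ) d → (∀ r ∈ R, d r = 0) →
          ∀ r ∈ φ.ker, d r = 0 := by
  obtain ⟨P, d, ε, hε, h0, h1, hproj, hfin⟩ := hG
  have := hproj 0
  have := hproj 1
  have := hfin 0 (by norm_num)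
  have := hfin 1 (by norm_num)
  have := hfin 2 le_rfl
  have hfg := LinearMap.fg_ker_of_exact_of_projective hε h0 (h1 0)
    (trivialAugmentation_surjective K) (exact_foxBoundary_trivialAugmentation K φ hφ)
  obtain ⟨D, hD, hD'⟩ := IsCrossedHom.exists_freeGroup ((moduleAction K G _).comp φ)
    fun x : X => Finsupp.single x (1 : MonoidAlgebra K G)
  have hspan := ker_foxBoundary_eq_span hφ hD hD'
  rw [hspan] at hfg
  obtain ⟨t, ht, ht'⟩ := (Submodule.fg_span_iff_fg_span_finset_subset _).1 hfg
  obtain ⟨R, hR, hRt⟩ := Set.exists_subset_bijOn (φ.ker ∩ D ⁻¹' t : Set (FreeGroup X)) D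
  have him : D '' R = t := by
    rw [hRt.image_eq]
    ext v
    constructor
    · rintro ⟨r, hr, rfl⟩
      exact hr.2
    · intro hv
      obtain ⟨r, hr, rfl⟩ := ht hv
      exact ⟨r, ⟨hr, hv⟩, rfl⟩
  refine ⟨R, ?_, fun r hr => (hR hr).1, ?_⟩
  · exact Set.Finite.of_finite_image (him ▸ t.finite_toSet) hRt.injOn
  intro A _ _ e he heR r hr
  -- `D` is universal: `e` factors as a linear map after `D`.
  let l : (X →₀ MonoidAlgebra K G) →ₗ[MonoidAlgebra K G] A :=
    Finsupp.linearCombination _ fun x => e (FreeGroup.of x)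
  have hl : ∀ f, l (D f) = e f :=
    IsCrossedHom.eq_of_freeGroup (ρ := (moduleAction K G _).comp φ)
      (hD.map l.toAddMonoidHom fun x a => map_smul l _ _) he (fun x => by simp [hD', l])
  have hmem : D r ∈ Submodule.span (MonoidAlgebra K G) (t : Set _) := by
    rw [← ht']
    exact Submodule.subset_span ⟨r, hr, rfl⟩
  have hle : Submodule.span (MonoidAlgebra K G) (t : Set _) ≤ LinearMap.ker l := by
    rw [Submodule.span_le, ← him]
    rintro _ ⟨q, hq, rfl⟩
    exact (hl q).trans (heR q hq)
  rw [← hl]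
  exact hle hmem

end FoxCalculus

/-! ### Edge chains and injectivity on HNN extensions -/

namespace HNNExtension

variable {B : Type*} [Group B] {S T : Subgroup B} {μ : S ≃* T}

variable (S T μ) in
/-- The elements of an HNN extension that can be written with `n` occurrences of the stable letter
or its inverse. -/
inductive HasLetters : ℕ → HNNExtension B S T μ → Prop
  | of (b : B) : HasLetters 0 (of b)
  | of_t_mul (b : B) {n : ℕ} {x : HNNExtension B S T μ} (hx : HasLetters n x) :
      HasLetters (n + 1) (of b * (t * x))
  | of_t_inv_mul (b : B) {n : ℕ} {x : HNNExtension B S T μ} (hx : HasLetters n x) :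
      HasLetters (n + 1) (of b * (t⁻¹ * x))

namespace HasLetters

variable {n m : ℕ} {x y : HNNExtension B S T μ}

theorem of_mul (b : B) (hx : HasLetters S T μ n x) : HasLetters S T μ n (HNNExtension.of b * x) := by
  cases hx with
  | of c => rw [← map_mul]; exact .of _
  | of_t_mul c hx => rw [← mul_assoc, ← map_mul]; exact .of_t_mul _ hx
  | of_t_inv_mul c hx => rw [← mul_assoc, ← map_mul]; exact .of_t_inv_mul _ hx

theorem mul (hx : HasLetters S T μ n x) (hy : HasLetters S T μ m y) :
    HasLetters S T μ (n + m) (x * y) := by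
  induction hx with
  | of b => rw [zero_add]; exact hy.of_mul b
  | of_t_mul b _ ih => rw [add_right_comm, mul_assoc, mul_assoc]; exact .of_t_mul b ih
  | of_t_inv_mul b _ ih => rw [add_right_comm, mul_assoc, mul_assoc]; exact .of_t_inv_mul b ih

theorem t : HasLetters S T μ 1 HNNExtension.t := by
  simpa using HasLetters.of_t_mul (μ := μ) 1 (.of 1)

theorem t_inv : HasLetters S T μ 1 HNNExtension.t⁻¹ := by
  simpa using HasLetters.of_t_inv_mul (μ := μ) 1 (.of 1)

theorem inv (hx : HasLetters S T μ n x) : HasLetters S T μ n x⁻¹ := by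
  induction hx with
  | of b => rw [← map_inv]; exact .of _
  | of_t_mul b _ ih =>
    rw [mul_inv_rev, mul_inv_rev, ← map_inv]
    exact (ih.mul t_inv).mul (.of _)
  | of_t_inv_mul b _ ih =>
    rw [mul_inv_rev, mul_inv_rev, inv_inv, ← map_inv]
    exact (ih.mul t).mul (.of _)

end HasLetters

theorem exists_hasLetters (x : HNNExtension B S T μ) : ∃ n, HasLetters S T μ n x := by
  induction x using HNNExtension.induction_on with
  | of b => exact ⟨0, .of b⟩
  | t => exact ⟨1, .t⟩
  | mul x y hx hy => exact ⟨_, hx.choose_spec.mul hy.choose_spec⟩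
  | inv x hx => exact ⟨_, hx.choose_spec.inv⟩

variable {G : Type*} [Group G] (τ : HNNExtension B S T μ →* G)

/-- The image in `G` of the second associated subgroup. -/
abbrev edgeStabilizer : Subgroup G := T.map (τ.comp of)

variable {K : Type*} [CommRing K]

/-- The module of `K`-valued chains on the edges of the graph with vertices the cosets of the base
and edges the cosets of the second associated subgroup. -/
abbrev EdgeModule (K : Type*) [CommRing K] : Type _ :=
  (Representation.ofMulAction K G (G ⧸ edgeStabilizer τ)).asModule

/-- The coefficient of a chain at an edge. -/
noncomputable def edgeCoeff (e : G ⧸ edgeStabilizer τ) : EdgeModule τ K →+ K :=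
  (Finsupp.applyAddHom e).comp (MonoidAlgebra.coeffAddEquiv.toAddMonoidHom.comp
    (Representation.ofMulAction K G (G ⧸ edgeStabilizer τ)).asModuleEquiv.toLinearMap.toAddMonoidHom)

/-- The edge given by the trivial coset, as a chain. -/
noncomputable def baseEdge (K : Type*) [CommRing K] : EdgeModule τ K :=
  (Representation.ofMulAction K G (G ⧸ edgeStabilizer τ)).asModuleEquiv.symm
    (MonoidAlgebra.single ((1 : G) : G ⧸ edgeStabilizer τ) 1)

theorem edgeCoeff_smul (g : G) (e : G ⧸ edgeStabilizer τ) (a : EdgeModule τ K) :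
    edgeCoeff τ e (MonoidAlgebra.moduleAction K G _ g a) = edgeCoeff τ (g⁻¹ • e) a := by
  obtain ⟨a, rfl⟩ :=
    (Representation.ofMulAction K G (G ⧸ edgeStabilizer τ)).asModuleEquiv.symm.surjective a
  rw [MonoidAlgebra.moduleAction_apply, ← Representation.asModuleEquiv_symm_map_rho]
  exact Representation.coeff_ofMulAction g a e

theorem edgeCoeff_baseEdge_self :
    edgeCoeff τ ((1 : G) : G ⧸ edgeStabilizer τ) (baseEdge τ K) = 1 := by
  simp [edgeCoeff, baseEdge]

theorem eq_of_edgeCoeff_baseEdge_ne_zero {e : G ⧸ edgeStabilizer τ}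
    (h : edgeCoeff τ e (baseEdge τ K) ≠ 0) : e = ((1 : G) : G ⧸ edgeStabilizer τ) := by
  contrapose! h
  simp [edgeCoeff, baseEdge, h.symm]

theorem of_smul_baseEdge (s : T) :
    MonoidAlgebra.moduleAction K G _ (τ (of (s : B))) (baseEdge τ K) = baseEdge τ K := by
  rw [MonoidAlgebra.moduleAction_apply, baseEdge, ← Representation.asModuleEquiv_symm_map_rho,
    Representation.ofMulAction_single]
  congr 2
  rw [MulAction.Quotient.smul_coe, QuotientGroup.eq]
  simp only [smul_eq_mul, mul_one]
  exact inv_mem ⟨s, s.2, rfl⟩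

variable (K) in
theorem exists_edgeDerivation :
    ∃ d : HNNExtension B S T μ → EdgeModule τ K,
      IsCrossedHom ((MonoidAlgebra.moduleAction K G _).comp τ) d ∧
        (∀ b, d (of b) = 0) ∧ d t = baseEdge τ K :=
  IsCrossedHom.exists_hnnExtension _ _ fun s => of_smul_baseEdge τ s

variable {τ} {d : HNNExtension B S T μ → EdgeModule τ K}

theorem edgeCoeff_mul (hd : IsCrossedHom ((MonoidAlgebra.moduleAction K G _).comp τ) d)
    (x y : HNNExtension B S T μ) (e : G ⧸ edgeStabilizer τ) :
    edgeCoeff τ e (d (x * y)) = edgeCoeff τ e (d x) + edgeCoeff τ ((τ x)⁻¹ • e) (d y) := by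
  rw [hd, map_add, ← edgeCoeff_smul]
  rfl

theorem edgeCoeff_t_inv (hd : IsCrossedHom ((MonoidAlgebra.moduleAction K G _).comp τ) d)
    (ht : d t = baseEdge τ K) (e : G ⧸ edgeStabilizer τ) :
    edgeCoeff τ e (d t⁻¹) = -edgeCoeff τ (τ t • e) (baseEdge τ K) := by
  have := edgeCoeff_mul hd t⁻¹ t e
  rw [inv_mul_cancel, hd.map_one, map_zero, map_inv, inv_inv, ht] at this
  exact eq_neg_of_add_eq_zero_left this.symm

/-- An edge with non-zero coefficient in `d x` lies on the path spelled by a word for `x`. -/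
theorem HasLetters.exists_of_edgeCoeff_ne_zero
    (hd : IsCrossedHom ((MonoidAlgebra.moduleAction K G _).comp τ) d)
    (hof : ∀ b, d (HNNExtension.of b) = 0) (ht : d HNNExtension.t = baseEdge τ K)
    {n : ℕ} {x : HNNExtension B S T μ} (hx : HasLetters S T μ n x) {e : G ⧸ edgeStabilizer τ}
    (he : edgeCoeff τ e (d x) ≠ 0) :
    ∃ i j p q, i + j + 1 = n ∧ HasLetters S T μ i p ∧ HasLetters S T μ j q ∧
      (x = p * (HNNExtension.t * q) ∧ e = (τ p : G ⧸ edgeStabilizer τ) ∨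
        x = p * (HNNExtension.t⁻¹ * q) ∧
          e = (τ (p * HNNExtension.t⁻¹) : G ⧸ edgeStabilizer τ)) := by
  induction hx generalizing e with
  | of b => simp [hof] at he
  | @of_t_mul b n x hx ih =>
    rw [edgeCoeff_mul hd, edgeCoeff_mul hd, hof, map_zero, zero_add, ht] at he
    by_cases h : edgeCoeff τ ((τ (HNNExtension.of b))⁻¹ • e) (baseEdge τ K) = 0
    · rw [h, zero_add] at he
      obtain ⟨i, j, p, q, hij, hp, hq, hpq⟩ := ih he
      refine ⟨i + 1, j, _, q, by omega, .of_t_mul b hp, hq, ?_⟩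
      simp only [inv_smul_eq_iff] at hpq
      refine hpq.imp (fun h => ?_) fun h => ?_
      · rw [h.1, h.2]
        exact ⟨by group, by simp⟩
      · rw [h.1, h.2]
        exact ⟨by group, by simp [mul_assoc]⟩
    · refine ⟨0, n, _, x, by omega, .of b, hx, Or.inl ⟨rfl, ?_⟩⟩
      have := eq_of_edgeCoeff_baseEdge_ne_zero τ h
      rw [inv_smul_eq_iff] at this
      simp [this]
  | @of_t_inv_mul b n x hx ih =>
    rw [edgeCoeff_mul hd, edgeCoeff_mul hd, hof, map_zero, zero_add, edgeCoeff_t_inv hd ht] at he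
    by_cases h : edgeCoeff τ (τ HNNExtension.t • (τ (HNNExtension.of b))⁻¹ • e) (baseEdge τ K) = 0
    · rw [h, neg_zero, zero_add] at he
      obtain ⟨i, j, p, q, hij, hp, hq, hpq⟩ := ih he
      refine ⟨i + 1, j, _, q, by omega, .of_t_inv_mul b hp, hq, ?_⟩
      simp only [inv_smul_eq_iff] at hpq
      refine hpq.imp (fun h => ?_) fun h => ?_
      · rw [h.1, h.2]
        exact ⟨by group, by simp⟩
      · rw [h.1, h.2]
        exact ⟨by group, by simp [mul_assoc]⟩
    · refine ⟨0, n, _, x, by omega, .of b, hx, Or.inr ⟨rfl, ?_⟩⟩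
      have := eq_of_edgeCoeff_baseEdge_ne_zero τ h
      rw [← eq_inv_smul_iff, inv_smul_eq_iff] at this
      simp [this]

theorem mem_edgeStabilizer_iff {g : G} :
    g ∈ edgeStabilizer τ ↔ ∃ s : T, τ (HNNExtension.of (s : B)) = g := by
  simp [edgeStabilizer]

/-- A homomorphism from an HNN extension that is injective on the base group and whose kernel is
not seen by the edge derivation is injective. -/
theorem injective_of_edgeDerivation_eq_zero [Nontrivial K]
    (hd : IsCrossedHom ((MonoidAlgebra.moduleAction K G _).comp τ) d)
    (hof : ∀ b, d (of b) = 0) (ht : d t = baseEdge τ K)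
    (hinj : Function.Injective (τ.comp of)) (h0 : ∀ x ∈ τ.ker, d x = 0) :
    Function.Injective τ := by
  -- Induction on the number of stable letters. The first edge of a closed path contributes `±1` to
  -- a zero chain, so the path crosses it again; cutting there leaves shorter words to which
  -- induction applies.
  have key : ∀ n x, HasLetters S T μ n x → τ x ∈ (τ.comp of).range → x ∈ (of (φ := μ)).range := by
    intro n
    induction n using Nat.strong_induction_on with
    | _ n ih =>
    have edge : ∀ m x, m < n → HasLetters S T μ m x → τ x ∈ edgeStabilizer τ →
        ∃ s : T, x = of (s : B) := by
      intro m x hm hx hxT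
      obtain ⟨s, hs⟩ := mem_edgeStabilizer_iff.1 hxT
      obtain ⟨b, rfl⟩ := ih m hm x hx ⟨s, hs⟩
      exact ⟨s, congrArg of (hinj hs).symm⟩
    have main : ∀ x, HasLetters S T μ n x → τ x = 1 → x ∈ (of (φ := μ)).range := by
      have one_eq : ∀ g : G, ((1 : G) : G ⧸ edgeStabilizer τ) = g → g ∈ edgeStabilizer τ :=
        fun g hg => by simpa using QuotientGroup.eq.1 hg
      have step : ∀ m x, m < n → HasLetters S T μ m x → τ x = 1 → x ∈ (of (φ := μ)).range :=
        fun m x hm hx h1 => ih m hm x hx (h1 ▸ one_mem _)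
      have pos : ∀ m y, m + 1 = n → HasLetters S T μ m y → τ (t * y) = 1 →
          t * y ∈ (of (φ := μ)).range := by
        intro m y hm hy h1
        have hc : edgeCoeff τ ((τ t)⁻¹ • ((1 : G) : G ⧸ edgeStabilizer τ)) (d y) ≠ 0 := by
          intro hc
          have := edgeCoeff_mul hd t y ((1 : G) : G ⧸ edgeStabilizer τ)
          rw [h0 _ h1, hc, ht, edgeCoeff_baseEdge_self, map_zero, add_zero] at this
          exact zero_ne_one this
        obtain ⟨i, j, p, q, hij, hp, hq, ⟨rfl, he⟩ | ⟨rfl, he⟩⟩ :=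
          hy.exists_of_edgeCoeff_ne_zero hd hof ht hc
        -- Same direction: `t * p` equals some `s` in `T`, leaving `s * (t * q)`.
        · rw [inv_smul_eq_iff, MulAction.Quotient.smul_coe, smul_eq_mul, ← map_mul] at he
          obtain ⟨s, hs⟩ := edge (1 + i) _ (by omega) (HasLetters.t.mul hp) (one_eq _ he)
          rw [← mul_assoc, hs] at h1 ⊢
          exact step (1 + j) _ (by omega) ((HasLetters.t.mul hq).of_mul _) h1
        -- Opposite direction: `p` lies in `S`, so `t * p * t⁻¹` collapses into `T`.
        · rw [inv_smul_eq_iff, MulAction.Quotient.smul_coe, smul_eq_mul, ← map_mul] at he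
          obtain ⟨s, hs⟩ := mem_edgeStabilizer_iff.1 (one_eq _ he)
          have hp' : τ p = τ (of (μ.symm s : B)) := by
            rw [equiv_symm_eq_conj, map_mul, map_mul, hs, ← map_mul, ← map_mul]
            congr 1
            group
          obtain ⟨b, rfl⟩ := ih i (by omega) p hp (hp' ▸ ⟨_, rfl⟩)
          have hb : b = μ.symm s := hinj hp'
          rw [hb, ← mul_assoc, ← of_mul_t, mul_assoc, mul_inv_cancel_left] at h1 ⊢
          exact step j _ (by omega) (hq.of_mul _) h1
      have neg : ∀ m y, m + 1 = n → HasLetters S T μ m y → τ (t⁻¹ * y) = 1 →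
          t⁻¹ * y ∈ (of (φ := μ)).range := by
        intro m y hm hy h1
        have hc : edgeCoeff τ ((1 : G) : G ⧸ edgeStabilizer τ) (d y) ≠ 0 := by
          intro hc
          have := edgeCoeff_mul hd t⁻¹ y ((τ t)⁻¹ • ((1 : G) : G ⧸ edgeStabilizer τ))
          rw [h0 _ h1, edgeCoeff_t_inv hd ht, map_inv, inv_inv, smul_inv_smul, hc,
            edgeCoeff_baseEdge_self, map_zero, add_zero, zero_eq_neg] at this
          exact one_ne_zero this
        obtain ⟨i, j, p, q, hij, hp, hq, ⟨rfl, he⟩ | ⟨rfl, he⟩⟩ :=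
          hy.exists_of_edgeCoeff_ne_zero hd hof ht hc
        · obtain ⟨s, rfl⟩ := edge i p (by omega) hp (one_eq _ he)
          rw [← mul_assoc, inv_t_mul_of, mul_assoc, inv_mul_cancel_left] at h1 ⊢
          exact step j _ (by omega) (hq.of_mul _) h1
        · obtain ⟨s, hs⟩ := edge (i + 1) _ (by omega) (hp.mul HasLetters.t_inv) (one_eq _ he)
          rw [← mul_assoc p, hs, ← mul_assoc, inv_t_mul_of, mul_assoc] at h1 ⊢
          exact step (1 + j) _ (by omega) ((HasLetters.t_inv.mul hq).of_mul _) h1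
      -- A leading base element is moved to the end by conjugation, so the word may start with a
      -- stable letter.
      have conj : ∀ b (z : HNNExtension B S T μ), τ (of b * z) = 1 →
          (τ (z * of b) = 1 → z * of b ∈ (of (φ := μ)).range) →
          of b * z ∈ (of (φ := μ)).range := by
        intro b z h1 h
        have hb : of b ∈ (of (φ := μ)).range := ⟨b, rfl⟩
        rw [map_mul] at h1
        rw [map_mul, mul_eq_one_comm] at h
        rw [Subgroup.mul_mem_cancel_left _ hb]
        exact (Subgroup.mul_mem_cancel_right _ hb).1 (h h1)
      intro x hx h1
      cases hx with
      | of b => exact ⟨b, rfl⟩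
      | @of_t_mul b m y hy =>
        refine conj b _ h1 fun h => ?_
        rw [mul_assoc] at h ⊢
        exact pos m _ rfl (hy.mul (.of b)) h
      | @of_t_inv_mul b m y hy =>
        refine conj b _ h1 fun h => ?_
        rw [mul_assoc] at h ⊢
        exact neg m _ rfl (hy.mul (.of b)) h
    rintro x hx ⟨b, hb⟩
    have := main _ (hx.of_mul b⁻¹) (by
      rw [map_mul, ← hb, map_inv, map_inv]
      exact inv_mul_cancel _)
    rw [map_inv] at this
    exact (Subgroup.mul_mem_cancel_left _ (inv_mem (MonoidHom.mem_range.2 ⟨b, rfl⟩))).1 this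
  rw [injective_iff_map_eq_one]
  intro x hx
  obtain ⟨n, hn⟩ := exists_hasLetters x
  obtain ⟨b, rfl⟩ := key n x hn (hx ▸ one_mem _)
  rw [(injective_iff_map_eq_one _).1 hinj b hx, map_one]

end HNNExtension

/-! ### Conjugate subgroups and levels -/

namespace Subgroup

variable {G : Type*} [Group G]

/-- The conjugate `t S t⁻¹`. -/
def conjImage (t : G) (S : Subgroup G) : Subgroup G := S.map (MulAut.conj t).toMonoidHom

/-- Conjugation by `t` as an isomorphism of subgroups of a group `B` that contains both `S` and
`t S t⁻¹`. -/
noncomputable def conjEquivSubgroupOf (t : G) {B S : Subgroup G} (hS : S ≤ B)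
    (hT : conjImage t S ≤ B) :
    S.subgroupOf B ≃* (conjImage t S).subgroupOf B :=
  (subgroupOfEquivOfLe hS).trans
    ((S.equivMapOfInjective _ (MulAut.conj t).injective).trans (subgroupOfEquivOfLe hT).symm)

theorem conjEquivSubgroupOf_coe (t : G) {B S : Subgroup G} (hS : S ≤ B)
    (hT : conjImage t S ≤ B) (s : S.subgroupOf B) :
    ((conjEquivSubgroupOf t hS hT s : B) : G) = t * ((s : B) : G) * t⁻¹ := rfl

theorem FG.subgroupOf {B S : Subgroup G} (h : S.FG) (hS : S ≤ B) : (S.subgroupOf B).FG := by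
  rw [← Group.fg_iff_subgroup_fg] at h ⊢
  exact Group.fg_of_surjective (f := (subgroupOfEquivOfLe hS).symm.toMonoidHom)
    (subgroupOfEquivOfLe hS).symm.surjective

theorem FG.conjImage (t : G) {S : Subgroup G} (h : S.FG) : (conjImage t S).FG := by
  rw [← Group.fg_iff_subgroup_fg] at h ⊢
  exact Group.fg_of_surjective (f := (MulAut.conj t).toMonoidHom.subgroupMap S)
    ((MulAut.conj t).toMonoidHom.subgroupMap_surjective S)

/-- The subgroup generated by the conjugates `t ^ k * x i * t ^ (-k)` with `k ∈ s`. -/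
def levelClosure {ι : Type*} (t : G) (x : ι → G) (s : Set ℕ) : Subgroup G :=
  closure (Set.image2 (fun k i => t ^ k * x i * (t ^ k)⁻¹) s Set.univ)

section levelClosure

variable {ι : Type*} (t : G) (x : ι → G)

theorem levelClosure_fg [Finite ι] {s : Set ℕ} (hs : s.Finite) : (levelClosure t x s).FG :=
  (fg_iff _).2 ⟨_, rfl, hs.image2 _ Set.finite_univ⟩

theorem mem_levelClosure {s : Set ℕ} {k : ℕ} (hk : k ∈ s) (i : ι) :
    t ^ k * x i * (t ^ k)⁻¹ ∈ levelClosure t x s :=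
  subset_closure ⟨k, hk, i, Set.mem_univ i, rfl⟩

theorem levelClosure_mono {s s' : Set ℕ} (h : s ⊆ s') : levelClosure t x s ≤ levelClosure t x s' :=
  closure_mono (Set.image2_subset_right h)

theorem levelClosure_Iio_le (n : ℕ) :
    levelClosure t x (Set.Iio n) ≤ levelClosure t x (Set.Iic n) :=
  levelClosure_mono t x Set.Iio_subset_Iic_self

theorem conjImage_levelClosure_Iio_le (n : ℕ) :
    conjImage t (levelClosure t x (Set.Iio n)) ≤ levelClosure t x (Set.Iic n) := by
  rw [conjImage, map_le_iff_le_comap, levelClosure, closure_le]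
  rintro _ ⟨k, hk, i, -, rfl⟩
  have := mem_levelClosure t x (s := Set.Iic n) (k := k + 1) (Nat.succ_le_of_lt hk) i
  rw [SetLike.mem_coe, mem_comap]
  convert this using 1
  simp [pow_succ', mul_assoc]

theorem levelClosure_le_ker {H : Type*} [Group H] {χ : G →* H} (hx : ∀ i, χ (x i) = 1)
    (s : Set ℕ) : levelClosure t x s ≤ χ.ker := by
  rw [levelClosure, closure_le]
  rintro _ ⟨k, hk, i, -, rfl⟩
  simp [MonoidHom.mem_ker, hx]

end levelClosure

end Subgroup

/-! ### The approximating HNN extensions -/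

namespace HNNExtension

open Subgroup

variable {G : Type*} [Group G] {ι : Type*} (t' : G) (x : ι → G) (n : ℕ)

/-- The HNN extension with base generated by the levels `0, …, n` and associated subgroups
generated by the levels `0, …, n - 1` and `1, …, n`. -/
abbrev Level : Type _ :=
  HNNExtension (levelClosure t' x (Set.Iic n)) _ _
    (conjEquivSubgroupOf t' (levelClosure_Iio_le t' x n) (conjImage_levelClosure_Iio_le t' x n))

namespace Level

/-- The canonical homomorphism to the ambient group. -/
noncomputable def toGroup : Level t' x n →* G :=
  lift (Subgroup.subtype _) t' fun s => by
    simp [conjEquivSubgroupOf_coe]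

theorem toGroup_of (b : levelClosure t' x (Set.Iic n)) : toGroup t' x n (of b) = b :=
  lift_of _ _ _ b

theorem toGroup_t : toGroup t' x n t = t' :=
  lift_t _ _ _

/-- The generator `x i` as an element of the base group. -/
def gen (i : ι) : levelClosure t' x (Set.Iic n) :=
  ⟨x i, by simpa using mem_levelClosure t' x (s := Set.Iic n) (k := 0) (Nat.zero_le n) i⟩

/-- The homomorphism from the free group on `t` and the `x i`. -/
noncomputable def ofFree : FreeGroup (Option ι) →* Level t' x n :=
  FreeGroup.lift fun o => o.elim t fun i => of (gen t' x n i)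

theorem ofFree_none : ofFree t' x n (FreeGroup.of none) = t := by
  simp [ofFree]

theorem ofFree_some (i : ι) : ofFree t' x n (FreeGroup.of (some i)) = of (gen t' x n i) := by
  simp [ofFree]

theorem toGroup_comp_ofFree :
    (toGroup t' x n).comp (ofFree t' x n) = FreeGroup.lift fun o => o.elim t' x := by
  refine FreeGroup.ext_hom _ _ fun o => ?_
  cases o with
  | none => simp [ofFree, toGroup_t]
  | some i => simp [ofFree, toGroup_of, gen]

theorem toGroup_comp_of_injective : Function.Injective ((toGroup t' x n).comp of) := by
  intro a b h
  rw [MonoidHom.comp_apply, MonoidHom.comp_apply, toGroup_of, toGroup_of] at h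
  exact Subtype.ext h

/-- Each conjugation by `t` raises the level by one, since levels below `n` lie in the first
associated subgroup. -/
theorem conj_gen {k : ℕ} (hk : k ≤ n) (i : ι) :
    t ^ k * of (gen t' x n i) * (t ^ k)⁻¹ =
      (of ⟨_, mem_levelClosure t' x (Set.mem_Iic.2 hk) i⟩ : Level t' x n) := by
  induction k with
  | zero =>
    rw [pow_zero, one_mul, inv_one, mul_one]
    congr 1
    ext
    simp [gen]
  | succ k ih =>
    have h : t ^ (k + 1) * of (gen t' x n i) * (t ^ (k + 1))⁻¹ =
        t * (t ^ k * of (gen t' x n i) * (t ^ k)⁻¹ : Level t' x n) * t⁻¹ := by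
      simp [pow_succ', mul_assoc]
    rw [h, ih (by omega)]
    let s : (levelClosure t' x (Set.Iio n)).subgroupOf (levelClosure t' x (Set.Iic n)) :=
      ⟨⟨_, mem_levelClosure t' x (Set.mem_Iic.2 (by omega : k ≤ n)) i⟩,
        mem_levelClosure t' x (Set.mem_Iio.2 hk) i⟩
    refine (equiv_eq_conj s).symm.trans ?_
    congr 1
    ext
    rw [conjEquivSubgroupOf_coe]
    simp [s, pow_succ', mul_assoc]

theorem ofFree_surjective : Function.Surjective (ofFree t' x n) := by
  rw [← MonoidHom.range_eq_top, Subgroup.eq_top_iff']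
  have ht : t ∈ (ofFree t' x n).range := ⟨_, ofFree_none t' x n⟩
  intro y
  induction y using HNNExtension.induction_on with
  | t => exact ht
  | mul a b ha hb => exact mul_mem ha hb
  | inv a ha => exact inv_mem ha
  | of b =>
    obtain ⟨b, hb⟩ := b
    induction hb using Subgroup.closure_induction with
    | mem g hg =>
      obtain ⟨k, hk, i, -, rfl⟩ := hg
      have := conj_gen t' x n hk i
      rw [← this]
      exact mul_mem (mul_mem (pow_mem ht k) ⟨_, ofFree_some t' x n i⟩) (inv_mem (pow_mem ht k))
    | one => exact (map_one (of (φ := conjEquivSubgroupOf t' (levelClosure_Iio_le t' x n)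
        (conjImage_levelClosure_Iio_le t' x n)))).symm ▸ one_mem _
    | mul a b ha hb iha ihb =>
      have := mul_mem iha ihb
      rwa [← map_mul] at this
    | inv a ha iha =>
      have := inv_mem iha
      rwa [← map_inv] at this

variable {t' x}

/-- Read `f` as a path of heights starting at `p`: each letter `x i` met at height `k` contributes a
level-`k` generator or its inverse. Large `p` keeps the heights non-negative, large `n` keeps them
at most `n`. -/
theorem exists_eventually_conj_ofFree_mem_range {χ : G →* Multiplicative ℤ}
    (ht : χ t' = Multiplicative.ofAdd 1) (hx : ∀ i, χ (x i) = 1) (f : FreeGroup (Option ι)) :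
    ∃ a : ℤ, ∀ p ≥ a, ∃ N, ∀ n ≥ N,
      t ^ p * ofFree t' x n f *
        (t ^ (p + (χ (FreeGroup.lift (fun o => o.elim t' x) f)).toAdd))⁻¹ ∈
          (of : _ →* Level t' x n).range := by
  have level : ∀ p : ℤ, 0 ≤ p → ∀ i, ∀ n ≥ p.toNat,
      t ^ p * of (gen t' x n i) * (t ^ p)⁻¹ ∈ (of : _ →* Level t' x n).range := by
    intro p hp i n hn
    obtain ⟨k, rfl⟩ := Int.eq_ofNat_of_zero_le hp
    rw [zpow_natCast, conj_gen t' x n (by simpa using hn)]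
    exact ⟨_, rfl⟩
  induction f using FreeGroup.induction_on with
  | C1 => exact ⟨0, fun p _ => ⟨0, fun n _ => by simp⟩⟩
  | of o =>
    refine ⟨0, fun p hp => ⟨p.toNat, fun n hn => ?_⟩⟩
    cases o with
    | none => simp [ofFree_none, ht, zpow_add]
    | some i => simpa [ofFree_some, hx] using level p hp i n hn
  | inv_of o _ =>
    refine ⟨0, fun p hp => ⟨p.toNat, fun n hn => ?_⟩⟩
    cases o with
    | none => simp [ofFree_none, ht, zpow_add]
    | some i =>
      have := inv_mem (level p hp i n hn)
      rw [conj_inv] at this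
      simpa [ofFree_some, hx] using this
  | mul f g hf hg =>
    obtain ⟨a, ha⟩ := hf
    obtain ⟨b, hb⟩ := hg
    let c := (χ (FreeGroup.lift (fun o => o.elim t' x) f)).toAdd
    -- The path of `g` starts at height `p + c`, which must be at least `b`.
    refine ⟨max a (b - c), fun p hp => ?_⟩
    obtain ⟨N, hN⟩ := ha p (le_trans (le_max_left _ _) hp)
    obtain ⟨M, hM⟩ := hb (p + c) (by linarith [le_trans (le_max_right _ _) hp])
    refine ⟨max N M, fun n hn => ?_⟩
    have := mul_mem (hN n (le_trans (le_max_left _ _) hn)) (hM n (le_trans (le_max_right _ _) hn))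
    convert this using 1
    rw [map_mul, map_mul, map_mul, toAdd_mul, ← add_assoc]
    generalize (χ (FreeGroup.lift (fun o => o.elim t' x) g)).toAdd = e
    change _ * (t ^ (p + c + e))⁻¹ = t ^ p * ofFree t' x n f * (t ^ (p + c))⁻¹ * _
    group

/-- Every relator of the ambient group holds in the HNN extensions of high level. -/
theorem exists_eventually_ofFree_eq_one {χ : G →* Multiplicative ℤ}
    (ht : χ t' = Multiplicative.ofAdd 1) (hx : ∀ i, χ (x i) = 1) {r : FreeGroup (Option ι)}
    (hr : FreeGroup.lift (fun o => o.elim t' x) r = 1) :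
    ∃ N, ∀ n ≥ N, ofFree t' x n r = 1 := by
  obtain ⟨a, ha⟩ := exists_eventually_conj_ofFree_mem_range ht hx r
  obtain ⟨N, hN⟩ := ha a le_rfl
  refine ⟨N, fun n hn => ?_⟩
  obtain ⟨b, hb⟩ := hN n hn
  rw [hr, map_one, toAdd_one, add_zero] at hb
  have hr' : toGroup t' x n (ofFree t' x n r) = 1 := by
    rw [← MonoidHom.comp_apply, toGroup_comp_ofFree, hr]
  -- A conjugate of the relator lies in the base, where the map to `G` is injective.
  have hb' : b = 1 := toGroup_comp_of_injective t' x n (by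
    rw [MonoidHom.comp_apply, hb, map_mul, map_mul, hr', mul_one, ← map_mul, mul_inv_cancel,
      map_one, map_one])
  rwa [hb', map_one, eq_comm, conj_eq_one_iff] at hb

end Level

end HNNExtension

/-! ### Conclusion -/

theorem Group.IsTypeFP.exists_toGroup_bijective {G : Type*} [Group G] {K : Type*} [CommRing K]
    [Nontrivial K] (hG : Group.IsTypeFP K G 2) {χ : G →* Multiplicative ℤ} {t : G}
    (ht : χ t = Multiplicative.ofAdd 1) {ι : Type*} [Finite ι] {x : ι → G} (hx : ∀ i, χ (x i) = 1)
    (hφ : Function.Surjective (FreeGroup.lift fun o : Option ι => o.elim t x)) :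
    ∃ n, Function.Bijective (HNNExtension.Level.toGroup t x n) := by
  obtain ⟨R, hRfin, hR, hd⟩ := hG.exists_finite_relators hφ
  have hev : ∀ r ∈ R, ∃ N, ∀ n ≥ N, HNNExtension.Level.ofFree t x n r = 1 := fun r hr =>
    HNNExtension.Level.exists_eventually_ofFree_eq_one ht hx (hR hr)
  have hev' : ∀ᶠ n in Filter.atTop, ∀ r ∈ R, HNNExtension.Level.ofFree t x n r = 1 :=
    (Filter.eventually_all_finite hRfin).2 fun r hr => Filter.eventually_atTop.2 (hev r hr)
  obtain ⟨n, hn⟩ := hev'.exists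
  have hcomp := HNNExtension.Level.toGroup_comp_ofFree t x n
  refine ⟨n, ?_, ?_⟩
  · obtain ⟨d, hdc, hof, hdt⟩ :=
      HNNExtension.exists_edgeDerivation (HNNExtension.Level.toGroup t x n) K
    refine HNNExtension.injective_of_edgeDerivation_eq_zero hdc hof hdt
      (HNNExtension.Level.toGroup_comp_of_injective t x n) fun y hy => ?_
    obtain ⟨r, rfl⟩ := HNNExtension.Level.ofFree_surjective t x n y
    -- Pulled back to the free group, the edge derivation vanishes on `R`, hence on all relators.
    refine hd (d ∘ HNNExtension.Level.ofFree t x n) ?_ (fun r hr => ?_) r ?_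
    · rw [← hcomp]
      exact hdc.comp _
    · rw [Function.comp_apply, hn r hr, hdc.map_one]
    · rwa [← hcomp]
  · rw [← hcomp, MonoidHom.coe_comp] at hφ
    exact hφ.of_comp

theorem theoremB3p1 {G : Type*} [Group G] [Group.FG G] {K : Type*} [CommRing K] [Nontrivial K]
    (hG : Group.IsTypeFP K G 2)
    (χ : G →* Multiplicative ℤ) (t : G) (ht : χ t = Multiplicative.ofAdd 1) :
    ∃ (B : Subgroup G) (S T : Subgroup B) (μ : S ≃* T),
      B ≤ χ.ker ∧ B.FG ∧ S.FG ∧ T.FG ∧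
      (∀ s : S, ((μ s : B) : G) = t * ((s : B) : G) * t⁻¹) ∧
      ∃ τ : HNNExtension B S T μ ≃* G,
        (∀ b : B, τ (HNNExtension.of b) = (b : G)) ∧ τ HNNExtension.t = t := by
  obtain ⟨Y, hY⟩ := Group.FG.out (G := G)
  -- A power of `t` corrects each generator into `ker χ`.
  let x : Y → G := fun y => y * (t ^ (χ y).toAdd)⁻¹
  have hx : ∀ y, χ (x y) = 1 := fun y => by
    simp [x, ht, ← ofAdd_zsmul]
  have hφ : Function.Surjective (FreeGroup.lift fun o : Option Y => o.elim t x) := by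
    rw [← MonoidHom.range_eq_top, eq_top_iff, ← hY, Subgroup.closure_le]
    intro y hy
    refine ⟨FreeGroup.of (some ⟨y, hy⟩) * FreeGroup.of none ^ (χ y).toAdd, ?_⟩
    simp [x]
  obtain ⟨n, hn⟩ := hG.exists_toGroup_bijective ht hx hφ
  exact ⟨_, _, _, _, Subgroup.levelClosure_le_ker t x hx _,
    Subgroup.levelClosure_fg t x (Set.finite_Iic n),
    (Subgroup.levelClosure_fg t x (Set.finite_Iio n)).subgroupOf
      (Subgroup.levelClosure_Iio_le t x n),
    (Subgroup.FG.conjImage t (Subgroup.levelClosure_fg t x (Set.finite_Iio n))).subgroupOf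
      (Subgroup.conjImage_levelClosure_Iio_le t x n),
    Subgroup.conjEquivSubgroupOf_coe t _ _, MulEquiv.ofBijective _ hn,
    HNNExtension.Level.toGroup_of t x n, HNNExtension.Level.toGroup_t t x n⟩
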